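/- **Theorem 5.2 (abstract branching rule).** Let $n\ge 1$, $B=\mathbb C[x_1,\dots,x_n]$, and let $\mathcal D_B$ be the Weyl algebra of polynomial differential operators on $B$, generated by $x_i,\partial_i$ ($1\le i\le n$). Put $\nabla=\sum_{i=1}^n x_i\partial_i$ and $\nabla_n=x_n\partial_n$. By a *graded subring* of $\mathcal D_B$ we mean a $\mathbb C$-subalgebra $\mathcal D\subset\mathcal D_B$ with $\nabla\in\mathcal D$ and $\mathcal D=\bigoplus_{k\in\mathbb Z}\mathcal D(k)$, where $\mathcal D(k)=\{P\in\mathcal D\mid [\nabla,P]=kP\}$; write $\mathcal D^0=\mathcal D(0)$, $\mathcal D^-=\bigoplus_{k<0}\mathcal D(k)$, and use the notation $(\cdot)^-$ in the same way for every subspace of $\mathcal D_B$ that is graded by the eigenvalues of $[\nabla,\cdot]$. Put $\mathcal D_B^{x_n^-}=\bigoplus_{k<0}\{P\in\mathcal D_B\mid[\nabla_n,P]=kP\}$. For a $\mathcal D$-submodule $M\subset B$ put $\mathrm{Ann}_{\mathcal D^-}(M)=\{v\in M\mid \mathcal D^-v=0\}$. Let $\mathcal D_2\subset\mathcal D_1$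 be graded subrings of $\mathcal D_B$ with $x_n,\partial_n\in\mathcal D_1$, and let $\tilde{\mathcal D}_1=\{P\in\mathcal D_1\mid[\partial_n,P]=0\}$. Assume that there is a graded Lie subalgebra $\mathfrak a_1$ of $\tilde{\mathcal D}_1$ (under the commutator) such that 1. $\mathfrak a_1^-\subset\tilde{\mathcal D}_1^-\subset\mathcal D_1^-\subset\mathcal D_1\mathfrak a_1^-+\mathcal D_B\partial_n$, 2. $\mathfrak a_1^-\subset\mathcal D_2^-+\mathcal D_B^{x_n^-}$. Let $N$ be a simple $\mathcal D_1$-submodule of $B$, and consider the conditions - (a) $\dim_{\mathbb C}\mathrm{Ann}_{\mathcal D_1^-}(N)=1$; - (b) $\dim_{\mathbb C}\mathrm{Ann}_{\mathcal D_2^-}(M)=1$ for every simple $\mathcal D_2$-submodule $M\subset N$. Put $\mathcal R_i=\mathcal D_i^0/(\mathcal D_i^0\cap\mathcal D_i\mathcal D_i^-)$ for $i=1,2$. Then: - (i) If $\mathcal R_1$ and $\mathcal R_2$ are commutative, then (a) and (b) hold. - (ii) If $B$ is semisimple as a $\mathcal D_2$-module and (a) and (b) hold, then the restriction of $N$ to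 $\mathcal D_2$ is an (internal) direct sum $\bigoplus_i M_i$ of pairwise non-isomorphic simple $\mathcal D_2$-submodules. -/

import Mathlib

attribute [local instance] LieRing.ofAssociativeRing LieAlgebra.ofAssociativeAlgebra

noncomputable section

namespace BranchRule

/-- The underlying vector space of the polynomial algebra `B = ℂ[x_i : i ∈ Fin n]`. It is given its
own name, with its additive group and its `ℂ`-module structure, so that `B` is only seen as a module
over rings of operators. -/
def Poly (n : ℕ) : Type := MvPolynomial (Fin n) ℂ

instance (n : ℕ) : AddCommGroup (Poly n) := inferInstanceAs (AddCommGroup (MvPolynomial (Fin n) ℂ))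

instance (n : ℕ) : Module ℂ (Poly n) := inferInstanceAs (Module ℂ (MvPolynomial (Fin n) ℂ))

/-- The algebra of all `ℂ`-linear endomorphisms of `B`. -/
abbrev Op (n : ℕ) : Type := Module.End ℂ (Poly n)

/-- The operator "multiply by `x_i`". -/
def mulX {n : ℕ} (i : Fin n) : Op n :=
  (LinearMap.mulLeft ℂ (MvPolynomial.X i) : MvPolynomial (Fin n) ℂ →ₗ[ℂ] MvPolynomial (Fin n) ℂ)

/-- The partial derivative `∂_i`. -/
def partialD {n : ℕ} (i : Fin n) : Op n :=
  ((MvPolynomial.pderiv i).toLinearMap : MvPolynomial (Fin n) ℂ →ₗ[ℂ] MvPolynomial (Fin n) ℂ)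

/-- The Weyl algebra `D_B` of polynomial differential operators on `B`, realised by its faithful
action on `B`: the subalgebra of operators generated by all `x_i` and `∂_i`. -/
def weyl (n : ℕ) : Subalgebra ℂ (Op n) :=
  Algebra.adjoin ℂ (Set.range mulX ∪ Set.range partialD)

/-- The Euler operator `∇ = ∑ x_i ∂_i`. -/
def euler (n : ℕ) : Op n := ∑ i, mulX i * partialD i

/-- The partial Euler operator `∇_i = x_i ∂_i`. -/
def eulerAt {n : ℕ} (i : Fin n) : Op n := mulX i * partialD i

/-- The operators `P` with `[T, P] = k P`. -/
def adEigen {n : ℕ} (T : Op n) (k : ℤ) : Submodule ℂ (Op n) where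
  carrier := {P | ⁅T, P⁆ = (k : ℂ) • P}
  add_mem' := by
    intro a b ha hb
    change ⁅T, _⁆ = _ at *
    rw [lie_add, ha, hb, smul_add]
  zero_mem' := by change ⁅T, (0 : Op n)⁆ = _; rw [lie_zero, smul_zero]
  smul_mem' := by
    intro c a ha
    change ⁅T, _⁆ = _ at *
    rw [lie_smul, ha, smul_comm]

/-- The part of a space `S` of operators that is of negative degree for `ad T`:
`⊕_{k < 0} {P ∈ S | [T, P] = k P}`. -/
def negPart {n : ℕ} (T : Op n) (S : Submodule ℂ (Op n)) : Submodule ℂ (Op n) :=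
  ⨆ k : ℤ, ⨆ _ : k < 0, S ⊓ adEigen T k

/-- `S` is graded (by the eigenvalues of `ad ∇`): it is the sum of its homogeneous parts. -/
def IsGraded {n : ℕ} (S : Submodule ℂ (Op n)) : Prop :=
  S = ⨆ k : ℤ, S ⊓ adEigen (euler n) k

/-- A graded subring of the Weyl algebra: a `ℂ`-subalgebra of `D_B` that contains the Euler
operator `∇` and is graded by the eigenvalues of `ad ∇`. -/
structure IsGradedSubring {n : ℕ} (D : Subalgebra ℂ (Op n)) : Prop where
  le_weyl : D ≤ weyl n
  euler_mem : euler n ∈ D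
  graded : IsGraded (Subalgebra.toSubmodule D)

/-- `D⁻`, the negative part of `D` for the grading by `∇`. -/
def neg {n : ℕ} (D : Subalgebra ℂ (Op n)) : Submodule ℂ (Op n) :=
  negPart (euler n) (Subalgebra.toSubmodule D)

/-- `D⁰ = {P ∈ D | [∇, P] = 0}`. -/
def degZero {n : ℕ} (D : Subalgebra ℂ (Op n)) : Subalgebra ℂ (Op n) where
  carrier := {P | P ∈ D ∧ ⁅euler n, P⁆ = 0}
  mul_mem' := by
    rintro a b ⟨ha, ha'⟩ ⟨hb, hb'⟩
    refine ⟨D.mul_mem ha hb, ?_⟩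
    rw [Ring.lie_def, sub_eq_zero] at *
    rw [← mul_assoc, ha', mul_assoc, hb', mul_assoc]
  add_mem' := by
    rintro a b ⟨ha, ha'⟩ ⟨hb, hb'⟩
    exact ⟨D.add_mem ha hb, by rw [lie_add, ha', hb', add_zero]⟩
  algebraMap_mem' := by
    intro r
    exact ⟨D.algebraMap_mem r, by
      rw [Ring.lie_def, sub_eq_zero]; exact (Algebra.commutes r _).symm⟩

/-- The left ideal `D D⁻` of `D`. -/
def leftNeg {n : ℕ} (D : Subalgebra ℂ (Op n)) : Submodule ℂ (Op n) :=
  Subalgebra.toSubmodule D * neg D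

lemma mul_mem_leftNeg {n : ℕ} {D : Subalgebra ℂ (Op n)} {Q P : Op n} (hQ : Q ∈ D)
    (hP : P ∈ leftNeg D) : Q * P ∈ leftNeg D := by
  have h : Q * P ∈ Subalgebra.toSubmodule D * (Subalgebra.toSubmodule D * neg D) :=
    Submodule.mul_mem_mul hQ hP
  rwa [← mul_assoc, Subalgebra.isIdempotentElem_toSubmodule] at h

lemma neg_mul_mem {n : ℕ} {D : Subalgebra ℂ (Op n)} {Q P : Op n} (hQ : Q ∈ degZero D)
    (hP : P ∈ neg D) : P * Q ∈ neg D := by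
  have h : neg D ≤ (neg D).comap (LinearMap.mulRight ℂ Q) := by
    refine iSup₂_le fun k hk R hR => ?_
    refine Submodule.mem_iSup_of_mem k (Submodule.mem_iSup_of_mem hk ⟨?_, ?_⟩)
    · exact D.mul_mem hR.1 hQ.1
    · have h1 : ⁅euler n, R⁆ = (k : ℂ) • R := hR.2
      have h2 : ⁅euler n, Q⁆ = 0 := hQ.2
      change ⁅euler n, R * Q⁆ = (k : ℂ) • (R * Q)
      rw [Ring.lie_def] at *
      rw [← smul_mul_assoc, ← h1, sub_mul, ← mul_assoc, mul_assoc R, mul_assoc R,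
        sub_eq_zero.mp h2]
  exact h hP

lemma leftNeg_mul_mem {n : ℕ} {D : Subalgebra ℂ (Op n)} {Q P : Op n} (hQ : Q ∈ degZero D)
    (hP : P ∈ leftNeg D) : P * Q ∈ leftNeg D := by
  refine Submodule.mul_induction_on hP (fun a ha b hb => ?_) (fun a b ha hb => ?_)
  · rw [mul_assoc]
    exact Submodule.mul_mem_mul ha (neg_mul_mem hQ hb)
  · rw [add_mul]
    exact add_mem ha hb

/-- The ideal `D⁰ ∩ D D⁻` of `D⁰`. -/
def zeroIdeal {n : ℕ} (D : Subalgebra ℂ (Op n)) : Ideal (degZero D) where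
  carrier := {P | (P : Op n) ∈ leftNeg D}
  add_mem' := fun ha hb => (leftNeg D).add_mem ha hb
  zero_mem' := zero_mem (leftNeg D)
  smul_mem' := fun c _ hP => mul_mem_leftNeg c.2.1 hP

instance {n : ℕ} (D : Subalgebra ℂ (Op n)) : (zeroIdeal D).IsTwoSided where
  mul_mem_of_left := fun {a} b ha => show (a : Op n) * b ∈ leftNeg D from leftNeg_mul_mem b.2 ha

/-- The ring `R = D⁰ / (D⁰ ∩ D D⁻)`. -/
abbrev weightRing {n : ℕ} (D : Subalgebra ℂ (Op n)) : Type := degZero D ⧸ zeroIdeal D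

/-- `D^{∂_i} = {P ∈ D | [∂_i, P] = 0}`. -/
def partialConst {n : ℕ} (i : Fin n) (D : Subalgebra ℂ (Op n)) : Subalgebra ℂ (Op n) :=
  D ⊓ Subalgebra.centralizer ℂ {partialD i}

/-- The lowest weight space `Ann_{D⁻}(N) = {v ∈ N | D⁻ v = 0}` of a `D`-submodule `N ⊆ B`. -/
def lowestWeight {n : ℕ} {D : Subalgebra ℂ (Op n)} (N : Submodule D (Poly n)) :
    Submodule ℂ (Poly n) where
  carrier := {v | v ∈ N ∧ ∀ P ∈ neg D, P v = 0}
  add_mem' := by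
    rintro a b ⟨ha, ha'⟩ ⟨hb, hb'⟩
    exact ⟨N.add_mem ha hb, fun P hP => by rw [map_add, ha' P hP, hb' P hP, add_zero]⟩
  zero_mem' := ⟨N.zero_mem, fun P _ => map_zero P⟩
  smul_mem' := by
    rintro c a ⟨ha, ha'⟩
    refine ⟨?_, fun P hP => by rw [map_smul, ha' P hP, smul_zero]⟩
    have h := N.smul_mem (algebraMap ℂ D c) ha
    exact h

/-- The restriction of a `D₁`-submodule of `B` to a subring `D₂ ⊆ D₁`. -/
def res {n : ℕ} {D₁ D₂ : Subalgebra ℂ (Op n)} (h : D₂ ≤ D₁) (N : Submodule D₁ (Poly n)) :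
    Submodule D₂ (Poly n) where
  carrier := N
  add_mem' := fun ha hb => N.add_mem ha hb
  zero_mem' := N.zero_mem
  smul_mem' := fun c _ hv => N.smul_mem (⟨c.1, h c.2⟩ : D₁) hv

end BranchRule

end

/-! Everything rests on degree: `∇` acts on `B` diagonally with natural-number eigenvalues and
finite-dimensional eigenspaces, so an operator that would lower a degree below zero gives zero.

For (i), the lowest weight vectors of a simple module all lie in one degree, and `D⁰` moves any
nonzero one to any other (`exists_degZero_apply_eq`). Operators in `D D⁻` kill them, so
commutativity of `R` makes `D⁰` act on them by commuting operators; an eigenvector argument then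
forces dimension one.

For (ii), let `v ∈ N` be killed by `D₂⁻`, of degree `m` in `x_n`. Then `∂_n^m v` is a lowest weight
vector for `D₁`: `a₁⁻` commutes with `∂_n^m`, its `D₂⁻` part kills `v`, and the rest lowers the
`x_n`-degree below `m`; condition 1 passes from `a₁⁻` and `∂_n` to `D₁⁻`. By (a) these leading terms
lie on a line, so in each degree the vectors of `N` killed by `D₂⁻` form at most a line
(`exists_smul_eq_of_neg_apply_eq_zero`). An isomorphism of simple submodules preserves degree and
lowest weight vectors, hence isomorphic summands would meet. -/

noncomputable section

namespace BranchRule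

open Module End

/-! ### Eigenspaces and stable subspaces -/

section Eigen

variable {K V : Type*} [Field K] [AddCommGroup V] [Module K V]

/-- An eigenvector that lies in the sum of the eigenspaces for the eigenvalues in `t` has its
eigenvalue in `t`. -/
lemma mem_of_mem_iSup_eigenspace {f : End K V} {t : Set K} {c : K} {w : V} (hw0 : w ≠ 0)
    (hw : w ∈ f.eigenspace c) (hwt : w ∈ ⨆ μ ∈ t, f.eigenspace μ) : c ∈ t := by
  by_contra hc
  have hd := (eigenspaces_iSupIndep f) c
  refine hw0 (Submodule.disjoint_def.mp hd w hw ?_)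
  have hle : ⨆ μ ∈ t, f.eigenspace μ ≤ ⨆ μ, ⨆ _ : μ ≠ c, f.eigenspace μ :=
    iSup₂_le fun μ hμ => le_iSup₂_of_le μ (fun h => hc (h ▸ hμ)) le_rfl
  exact hle hwt

/-- If a sum of eigenvectors with distinct eigenvalues lies in a stable subspace, then so does each
of its terms. -/
lemma mem_of_sum_eigenvectors_mem {f : End K V} {S : Submodule K V} (hS : ∀ v ∈ S, f v ∈ S)
    {x : K →₀ V} (hx : ∀ μ, x μ ∈ f.eigenspace μ) (hsum : (x.sum fun _ v => v) ∈ S) (μ : K) :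
    x μ ∈ S := by
  -- Modulo `S` the terms remain in eigenspaces for distinct eigenvalues and sum to zero, so each of
  -- them vanishes.
  let g : End K (V ⧸ S) := S.mapQ S f hS
  have hind := eigenspaces_iSupIndep g
  have hmem : ∀ ν, S.mkQ (x ν) ∈ g.eigenspace ν := fun ν => by
    rw [mem_eigenspace_iff]
    have h := mem_eigenspace_iff.mp (hx ν)
    change S.mkQ (f (x ν)) = _
    rw [h, map_smul]
  have hz : ∑ ν ∈ x.support, S.mkQ (x ν) = 0 := by
    rw [← map_sum]
    exact (Submodule.Quotient.mk_eq_zero S).mpr hsum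
  by_cases hμ : μ ∈ x.support
  · have h := (iSupIndep_iff_finsetSum_eq_zero_imp_eq_zero _).mp hind x.support
      (fun ν => S.mkQ (x ν)) (fun ν _ => hmem ν) hz μ hμ
    exact (Submodule.Quotient.mk_eq_zero S).mp h
  · rw [Finsupp.notMem_support_iff.mp hμ]
    exact S.zero_mem

/-- A subspace that is stable under a diagonalizable operator is the sum of its intersections with
the eigenspaces. -/
lemma le_iSup_inf_eigenspace {f : End K V} {S : Submodule K V} (hS : ∀ v ∈ S, f v ∈ S)
    (hf : ⨆ μ, f.eigenspace μ = ⊤) : S ≤ ⨆ μ, S ⊓ f.eigenspace μ := by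
  intro v hv
  obtain ⟨x, hx, rfl⟩ := (Submodule.mem_iSup_iff_exists_finsupp _ _).mp
    (hf ▸ Submodule.mem_top : v ∈ ⨆ μ, f.eigenspace μ)
  exact Submodule.sum_mem _ fun μ _ =>
    Submodule.mem_iSup_of_mem μ ⟨mem_of_sum_eigenvectors_mem hS hx hv μ, hx μ⟩

end Eigen

/-! ### Degrees of polynomials and of operators -/

lemma adEigen_apply_mem {n : ℕ} {T P : Op n} {k : ℤ} {c : ℂ} {v : Poly n}
    (hP : P ∈ adEigen T k) (hv : v ∈ T.eigenspace c) : P v ∈ T.eigenspace (c + k) := by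
  have h : ⁅T, P⁆ = (k : ℂ) • P := hP
  rw [mem_eigenspace_iff] at *
  have h' := LinearMap.congr_fun h v
  rw [Ring.lie_def, LinearMap.sub_apply, End.mul_apply, End.mul_apply, hv, map_smul,
    sub_eq_iff_eq_add] at h'
  rw [h', add_smul, add_comm, LinearMap.smul_apply]

/-- The monomial `a x^s` as an element of `B`. -/
def mono {n : ℕ} (s : Fin n →₀ ℕ) : ℂ →ₗ[ℂ] Poly n :=
  (MvPolynomial.monomial s : ℂ →ₗ[ℂ] MvPolynomial (Fin n) ℂ)

/-- The coefficient of `x^s` as a functional on `B`. -/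
def coeffAt {n : ℕ} (s : Fin n →₀ ℕ) : Poly n →ₗ[ℂ] ℂ :=
  (MvPolynomial.lcoeff ℂ s : MvPolynomial (Fin n) ℂ →ₗ[ℂ] ℂ)

open Classical in
lemma coeffAt_mono {n : ℕ} (s u : Fin n →₀ ℕ) (a : ℂ) :
    coeffAt s (mono u a) = if u = s then a else 0 := by
  refine (MvPolynomial.coeff_monomial s u a).trans ?_
  congr

lemma eq_top_of_mono_mem {n : ℕ} (W : Submodule ℂ (Poly n)) (h : ∀ s a, mono s a ∈ W) : W = ⊤ := by
  refine eq_top_iff.mpr fun p _ => ?_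
  exact MvPolynomial.induction_on' (P := fun q : MvPolynomial (Fin n) ℂ => @id (Poly n) q ∈ W)
    p h fun p q hp hq => W.add_mem hp hq

/-- `T` multiplies the monomial `x^s` by the natural number `wt s`. -/
def IsWeightOp {n : ℕ} (T : Op n) (wt : (Fin n →₀ ℕ) → ℕ) : Prop :=
  ∀ (s : Fin n →₀ ℕ) (a : ℂ), T (mono s a) = (wt s : ℂ) • mono s a

lemma isWeightOp_eulerAt {n : ℕ} (i : Fin n) : IsWeightOp (eulerAt i) (fun s => s i) := by
  intro s a
  rw [Nat.cast_smul_eq_nsmul]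
  exact MvPolynomial.X_mul_pderiv_monomial

lemma euler_eq_sum (n : ℕ) : euler n = ∑ i, eulerAt i := rfl

lemma isWeightOp_euler (n : ℕ) : IsWeightOp (euler n) (fun s => s.degree) := by
  intro s a
  rw [euler_eq_sum, LinearMap.sum_apply, Finset.sum_congr rfl fun i _ => isWeightOp_eulerAt i s a,
    ← Finset.sum_smul, ← Nat.cast_sum, ← Finsupp.degree_eq_sum]

namespace IsWeightOp

variable {n : ℕ} {T : Op n} {wt : (Fin n →₀ ℕ) → ℕ}

lemma iSup_eigenspace (hT : IsWeightOp T wt) :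
    ⨆ μ ∈ Set.range (Nat.cast : ℕ → ℂ), T.eigenspace μ = ⊤ :=
  eq_top_of_mono_mem _ fun s a => Submodule.mem_iSup_of_mem (wt s : ℂ)
    (Submodule.mem_iSup_of_mem ⟨_, rfl⟩ (mem_eigenspace_iff.mpr (hT s a)))

lemma iSup_eigenspace_eq_top (hT : IsWeightOp T wt) : ⨆ μ, T.eigenspace μ = ⊤ :=
  eq_top_iff.mpr (hT.iSup_eigenspace.ge.trans (iSup_mono fun _ => iSup_le fun _ => le_rfl))

/-- The descent arguments rest on this: a vector whose degree would be negative is zero. -/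
lemma exists_nat (hT : IsWeightOp T wt) {c : ℂ} {w : Poly n} (hw : w ∈ T.eigenspace c)
    (hw0 : w ≠ 0) : ∃ j : ℕ, (j : ℂ) = c :=
  mem_of_mem_iSup_eigenspace (t := Set.range (Nat.cast : ℕ → ℂ)) hw0 hw
    (hT.iSup_eigenspace ▸ Submodule.mem_top)

lemma coeffAt_apply (hT : IsWeightOp T wt) (s : Fin n →₀ ℕ) (p : Poly n) :
    coeffAt s (T p) = wt s * coeffAt s p := by
  classical
  have h : LinearMap.eqLocus (coeffAt s ∘ₗ T) ((wt s : ℂ) • coeffAt s) = ⊤ := by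
    refine eq_top_of_mono_mem _ fun u a => ?_
    rw [LinearMap.mem_eqLocus, LinearMap.comp_apply, hT u a, map_smul, LinearMap.smul_apply,
      coeffAt_mono]
    split_ifs with hus
    · rw [hus]
    · rw [smul_zero, smul_zero]
  exact LinearMap.mem_eqLocus.mp (h ▸ Submodule.mem_top : p ∈ LinearMap.eqLocus _ _)

end IsWeightOp

/-- Comparing coefficients, an eigenvector for `j` involves only monomials of degree `j`. Finiteness
later supplies an eigenvalue on the lowest weight space. -/
instance {n : ℕ} (d : ℂ) : FiniteDimensional ℂ ((euler n).eigenspace d) := by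
  by_cases h : ∃ j : ℕ, (j : ℂ) = d
  · obtain ⟨j, rfl⟩ := h
    let W : Submodule ℂ (Poly n) := MvPolynomial.restrictTotalDegree (Fin n) ℂ j
    have : FiniteDimensional ℂ W :=
      inferInstanceAs (Module.Finite ℂ (MvPolynomial.restrictTotalDegree (Fin n) ℂ j))
    have hle : (euler n).eigenspace (j : ℂ) ≤ W := by
      intro p hp
      refine (MvPolynomial.mem_restrictTotalDegree (Fin n) j (p : MvPolynomial (Fin n) ℂ)).mpr ?_
      refine Finset.sup_le fun s hs => ?_
      have h2 := (isWeightOp_euler n).coeffAt_apply s p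
      rw [mem_eigenspace_iff.mp hp, map_smul, smul_eq_mul] at h2
      have h3 := mul_right_cancel₀ (MvPolynomial.mem_support_iff.mp hs) h2
      exact (Nat.cast_injective h3).ge
    exact Submodule.finiteDimensional_of_le hle
  · have hb : (euler n).eigenspace d = ⊥ := by
      refine (Submodule.eq_bot_iff _).mpr fun w hw => ?_
      by_contra hw0
      exact h ((isWeightOp_euler n).exists_nat hw hw0)
    rw [hb]
    infer_instance

lemma partialD_mem_adEigen_eulerAt {n : ℕ} (i : Fin n) : partialD i ∈ adEigen (eulerAt i) (-1) := by
  change ⁅eulerAt i, partialD i⁆ = ((-1 : ℤ) : ℂ) • partialD i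
  refine LinearMap.ext fun p => ?_
  rw [Ring.lie_def]
  change (MvPolynomial.X i * MvPolynomial.pderiv i (MvPolynomial.pderiv i p) -
    MvPolynomial.pderiv i (MvPolynomial.X i * MvPolynomial.pderiv i p) : MvPolynomial (Fin n) ℂ) =
    ((-1 : ℤ) : ℂ) • MvPolynomial.pderiv i p
  rw [MvPolynomial.pderiv_mul, MvPolynomial.pderiv_X_self, Int.cast_neg, Int.cast_one, neg_smul,
    one_smul]
  ring

lemma pderiv_comm {σ R : Type*} [CommSemiring R] {i j : σ} (hj : j ≠ i) (p : MvPolynomial σ R) :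
    MvPolynomial.pderiv j (MvPolynomial.pderiv i p) =
      MvPolynomial.pderiv i (MvPolynomial.pderiv j p) := by
  ext s
  simp only [MvPolynomial.coeff_pderiv, Finsupp.add_apply, Finsupp.single_eq_of_ne hj,
    Finsupp.single_eq_of_ne hj.symm, add_zero, add_right_comm]
  ring_nf

lemma partialD_mem_adEigen_euler {n : ℕ} (i : Fin n) : partialD i ∈ adEigen (euler n) (-1) := by
  have h : ∀ j ≠ i, ⁅eulerAt j, partialD i⁆ = 0 := by
    intro j hj
    refine LinearMap.ext fun p => ?_
    rw [Ring.lie_def]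
    change (MvPolynomial.X j * MvPolynomial.pderiv j (MvPolynomial.pderiv i p) -
      MvPolynomial.pderiv i (MvPolynomial.X j * MvPolynomial.pderiv j p) :
        MvPolynomial (Fin n) ℂ) = 0
    have hc : MvPolynomial.pderiv j (MvPolynomial.pderiv i p) =
      MvPolynomial.pderiv i (MvPolynomial.pderiv j p) :=
      pderiv_comm hj p
    rw [MvPolynomial.pderiv_mul, MvPolynomial.pderiv_X_of_ne hj, hc]
    ring
  change ⁅euler n, partialD i⁆ = ((-1 : ℤ) : ℂ) • partialD i
  have hs : euler n = ∑ j, eulerAt j := rfl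
  rw [hs, sum_lie, Finset.sum_eq_single i (fun j _ hj => h j hj)
    (fun hi => absurd (Finset.mem_univ i) hi)]
  exact partialD_mem_adEigen_eulerAt i

/-! ### Lowest weight vectors of simple modules -/

section LowestWeight

variable {n : ℕ} {D : Subalgebra ℂ (Op n)}

lemma euler_mem_degZero (hD : IsGradedSubring D) : euler n ∈ degZero D :=
  ⟨hD.euler_mem, lie_self _⟩

lemma leftNeg_apply_eq_zero {v : Poly n} (hv : ∀ P ∈ neg D, P v = 0) {P : Op n}
    (hP : P ∈ leftNeg D) : P v = 0 := by
  refine Submodule.mul_induction_on hP (fun a _ b hb => ?_) (fun a b ha hb => ?_)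
  · rw [End.mul_apply, hv b hb, map_zero]
  · rw [LinearMap.add_apply, ha, hb, add_zero]

lemma degZero_apply_mem_lowestWeight {M : Submodule D (Poly n)} {Q : Op n} (hQ : Q ∈ degZero D)
    {v : Poly n} (hv : v ∈ lowestWeight M) : Q v ∈ lowestWeight M :=
  ⟨M.smul_mem (⟨Q, hQ.1⟩ : D) hv.1, fun P hP => hv.2 (P * Q) (neg_mul_mem hQ hP)⟩

/-- Split `P` by degree: the negative parts kill `v`, the degree-zero part is `Q`, and the positive
parts strictly raise the degree. -/
lemma exists_degZero_sub_mem (hD : IsGradedSubring D) {d : ℂ} {v : Poly n}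
    (hv : v ∈ (euler n).eigenspace d) (hneg : ∀ P ∈ neg D, P v = 0) {P : Op n} (hP : P ∈ D) :
    ∃ Q ∈ degZero D, P v - Q v ∈
      ⨆ μ ∈ {μ : ℂ | ∃ k : ℤ, 0 < k ∧ μ = d + k}, (euler n).eigenspace μ := by
  let ev : Op n →ₗ[ℂ] Poly n := LinearMap.applyₗ v
  have hle : Subalgebra.toSubmodule D ≤ Submodule.comap ev
      (Submodule.map ev (Subalgebra.toSubmodule (degZero D)) ⊔
        ⨆ μ ∈ {μ : ℂ | ∃ k : ℤ, 0 < k ∧ μ = d + k}, (euler n).eigenspace μ) := by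
    refine hD.graded.le.trans (iSup_le fun k R hR => ?_)
    rcases lt_trichotomy k 0 with hk | rfl | hk
    · have h0 : ev R = 0 := hneg R
        (Submodule.mem_iSup_of_mem k (Submodule.mem_iSup_of_mem hk hR))
      rw [Submodule.mem_comap, h0]
      exact zero_mem _
    · refine Submodule.mem_sup_left ⟨R, ⟨hR.1, ?_⟩, rfl⟩
      have h : ⁅euler n, R⁆ = ((0 : ℤ) : ℂ) • R := hR.2
      rw [h, Int.cast_zero, zero_smul]
    · exact Submodule.mem_sup_right (Submodule.mem_iSup_of_mem (d + k)
        (Submodule.mem_iSup_of_mem ⟨k, hk, rfl⟩ (adEigen_apply_mem hR.2 hv)))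
  obtain ⟨_, ⟨Q, hQ, rfl⟩, z, hz, hyz⟩ := Submodule.mem_sup.mp (hle hP)
  refine ⟨Q, hQ, ?_⟩
  have h : P v = Q v + z := hyz.symm
  rwa [h, add_sub_cancel_left]

lemma exists_apply_eq {M : Submodule D (Poly n)} (hM : IsSimpleModule D M) {v w : Poly n}
    (hv : v ∈ M) (hv0 : v ≠ 0) (hw : w ∈ M) : ∃ P ∈ D, P v = w := by
  obtain ⟨P, hP⟩ := IsSimpleModule.toSpanSingleton_surjective D (m := (⟨v, hv⟩ : M))
    (fun h => hv0 (congrArg Subtype.val h)) ⟨w, hw⟩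
  exact ⟨P, P.2, congrArg Subtype.val hP⟩

/-- A homogeneous lowest weight vector of a simple module has minimal degree. -/
lemma degree_le_of_lowestWeight (hD : IsGradedSubring D) {M : Submodule D (Poly n)}
    (hM : IsSimpleModule D M) {d e : ℂ} {v w : Poly n} (hv : v ∈ lowestWeight M) (hv0 : v ≠ 0)
    (hvd : v ∈ (euler n).eigenspace d) (hw : w ∈ M) (hw0 : w ≠ 0)
    (hwe : w ∈ (euler n).eigenspace e) : ∃ k : ℤ, 0 ≤ k ∧ e = d + k := by
  obtain ⟨P, hP, rfl⟩ := exists_apply_eq hM hv.1 hv0 hw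
  obtain ⟨Q, hQ, hPQ⟩ := exists_degZero_sub_mem hD hvd hv.2 hP
  refine mem_of_mem_iSup_eigenspace (t := {μ : ℂ | ∃ k : ℤ, 0 ≤ k ∧ μ = d + k}) hw0 hwe ?_
  rw [← sub_add_cancel (P v) (Q v)]
  refine add_mem (SetLike.le_def.mp (biSup_mono ?_) hPQ) ?_
  · rintro μ ⟨k, hk, rfl⟩
    exact ⟨k, hk.le, rfl⟩
  · have hQ' : Q ∈ adEigen (euler n) 0 := by
      change ⁅euler n, Q⁆ = ((0 : ℤ) : ℂ) • Q
      rw [hQ.2, Int.cast_zero, zero_smul]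
    exact Submodule.mem_iSup_of_mem (d + (0 : ℤ))
      (Submodule.mem_iSup_of_mem ⟨0, le_rfl, rfl⟩ (adEigen_apply_mem hQ' hvd))

/-- Every nonzero submodule of `B` contains a homogeneous lowest weight vector. -/
lemma exists_lowestWeight (hD : IsGradedSubring D) {M : Submodule D (Poly n)} (hM : M ≠ ⊥) :
    ∃ (d : ℂ) (v : Poly n), v ≠ 0 ∧ v ∈ lowestWeight M ∧ v ∈ (euler n).eigenspace d := by
  classical
  have hex : ∃ j : ℕ, ∃ v ∈ M, v ≠ 0 ∧ v ∈ (euler n).eigenspace (j : ℂ) := by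
    by_contra! hno
    let S : Submodule ℂ (Poly n) := M.restrictScalars ℂ
    have hS : ∀ v ∈ S, euler n v ∈ S := fun v hv => M.smul_mem (⟨euler n, hD.euler_mem⟩ : D) hv
    have hle := le_iSup_inf_eigenspace hS (isWeightOp_euler n).iSup_eigenspace_eq_top
    refine hM ((Submodule.eq_bot_iff M).mpr fun v hv => ?_)
    have hbot : ⨆ μ, S ⊓ (euler n).eigenspace μ ≤ ⊥ := by
      refine iSup_le fun μ w hw => ?_
      by_contra hw0
      obtain ⟨j, rfl⟩ := (isWeightOp_euler n).exists_nat hw.2 hw0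
      exact hno j w hw.1 hw0 hw.2
    exact hbot (hle hv)
  -- Take the least degree occurring in `M`; an operator of negative degree cannot send `v` to a
  -- nonzero vector.
  obtain ⟨v, hvM, hv0, hvd⟩ := Nat.find_spec hex
  refine ⟨_, v, hv0, ⟨hvM, fun P hP => ?_⟩, hvd⟩
  have hle : neg D ≤ LinearMap.ker (LinearMap.applyₗ v : Op n →ₗ[ℂ] Poly n) := by
    refine iSup₂_le fun k hk R hR => ?_
    by_contra hR0
    have hmem := adEigen_apply_mem hR.2 hvd
    obtain ⟨j, hj⟩ := (isWeightOp_euler n).exists_nat hmem hR0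
    have hlt : j < Nat.find hex := by
      have : (j : ℤ) = (Nat.find hex : ℤ) + k := by exact_mod_cast hj
      omega
    refine Nat.find_min hex hlt ⟨R v, M.smul_mem (⟨R, hR.1⟩ : D) hvM, hR0, ?_⟩
    rwa [hj]
  exact hle hP

/-- Stability under `∇` reduces to homogeneous vectors; two of these bound each other's degree from
below. -/
lemma lowestWeight_le_eigenspace (hD : IsGradedSubring D) {M : Submodule D (Poly n)}
    (hM : IsSimpleModule D M) {d : ℂ} {v : Poly n} (hv : v ∈ lowestWeight M) (hv0 : v ≠ 0)
    (hvd : v ∈ (euler n).eigenspace d) : lowestWeight M ≤ (euler n).eigenspace d := by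
  refine (le_iSup_inf_eigenspace (f := euler n)
    (fun w hw => degZero_apply_mem_lowestWeight (euler_mem_degZero hD) hw)
    (isWeightOp_euler n).iSup_eigenspace_eq_top).trans (iSup_le fun e w hw => ?_)
  by_cases hw0 : w = 0
  · rw [hw0]; exact zero_mem _
  obtain ⟨k, hk, rfl⟩ := degree_le_of_lowestWeight hD hM hv hv0 hvd hw.1.1 hw0 hw.2
  obtain ⟨l, hl, h⟩ := degree_le_of_lowestWeight hD hM hw.1 hw0 hw.2 hv.1 hv0 hvd
  have hkl : k + l = 0 := by
    rw [add_assoc, left_eq_add] at h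
    exact_mod_cast h
  have hk0 : k = 0 := by omega
  have := hw.2
  rwa [hk0, Int.cast_zero, add_zero] at this

/-- `D⁰` acts transitively on the nonzero lowest weight vectors of a simple module. -/
lemma exists_degZero_apply_eq (hD : IsGradedSubring D) {M : Submodule D (Poly n)}
    (hM : IsSimpleModule D M) {v w : Poly n} (hv : v ∈ lowestWeight M) (hv0 : v ≠ 0)
    (hw : w ∈ lowestWeight M) : ∃ Q ∈ degZero D, Q v = w := by
  have hMbot : M ≠ ⊥ := fun h => hv0 ((Submodule.eq_bot_iff M).mp h v hv.1)
  obtain ⟨d, u, hu0, hu, hud⟩ := exists_lowestWeight hD hMbot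
  have hle := lowestWeight_le_eigenspace hD hM hu hu0 hud
  obtain ⟨P, hP, rfl⟩ := exists_apply_eq hM hv.1 hv0 hw.1
  obtain ⟨Q, hQ, hPQ⟩ := exists_degZero_sub_mem hD (hle hv) hv.2 hP
  refine ⟨Q, hQ, ?_⟩
  by_contra hne
  -- `P v - Q v` has degree `d` but lies in the sum of the degrees above `d`.
  have h := mem_of_mem_iSup_eigenspace (sub_ne_zero.mpr (Ne.symm hne))
    (sub_mem (hle hw) (hle (degZero_apply_mem_lowestWeight hQ hv))) hPQ
  obtain ⟨k, hk, h⟩ := h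
  rw [left_eq_add] at h
  have : k = 0 := by exact_mod_cast h
  omega

/-- If `R = D⁰ / (D⁰ ∩ D D⁻)` is commutative, then every simple submodule of `B` has a
one-dimensional lowest weight space. -/
theorem finrank_lowestWeight_eq_one (hD : IsGradedSubring D)
    (hcomm : ∀ a b : weightRing D, a * b = b * a) {M : Submodule D (Poly n)}
    (hM : IsSimpleModule D M) : finrank ℂ (lowestWeight M) = 1 := by
  have hMbot : M ≠ ⊥ := by
    have := hM.nontrivial
    exact Submodule.nontrivial_iff_ne_bot.mp this
  obtain ⟨d, v, hv0, hv, hvd⟩ := exists_lowestWeight hD hMbot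
  have hle := lowestWeight_le_eigenspace hD hM hv hv0 hvd
  have : FiniteDimensional ℂ (lowestWeight M) := Submodule.finiteDimensional_of_le hle
  have hv0' : (⟨v, hv⟩ : lowestWeight M) ≠ 0 := fun h => hv0 (congrArg Subtype.val h)
  have : Nontrivial (lowestWeight M) := ⟨⟨_, _, hv0'⟩⟩
  refine (finrank_eq_one_iff_of_nonzero' _ hv0').mpr fun w => ?_
  obtain ⟨P, hP, hPv⟩ := exists_degZero_apply_eq hD hM hv hv0 w.2
  let f : End ℂ (lowestWeight M) :=
    P.restrict fun u hu => degZero_apply_mem_lowestWeight hP hu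
  obtain ⟨c, hc⟩ := exists_eigenvalue f
  obtain ⟨u, hu⟩ := hc.exists_hasEigenvector
  have hPu : P u = c • (u : Poly n) := congrArg Subtype.val hu.apply_eq_smul
  obtain ⟨Q, hQ, hQu⟩ := exists_degZero_apply_eq hD hM u.2
    (fun h => hu.2 (Subtype.ext h)) hv
  -- The commutator kills `u`, while `P Q u = P v = w` and `Q P u = c Q u = c v`; so `w = c v`.
  have hPQ : P * Q - Q * P ∈ leftNeg D := by
    have h := hcomm (Ideal.Quotient.mk _ ⟨P, hP⟩) (Ideal.Quotient.mk _ ⟨Q, hQ⟩)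
    rw [← map_mul, ← map_mul, Ideal.Quotient.eq] at h
    exact h
  have h0 := leftNeg_apply_eq_zero u.2.2 hPQ
  rw [LinearMap.sub_apply, End.mul_apply, End.mul_apply, hQu, hPu, map_smul, hQu, hPv,
    sub_eq_zero] at h0
  exact ⟨c, Subtype.ext h0.symm⟩

end LowestWeight

/-! ### From vectors killed by `D₂⁻` to lowest weight vectors for `D₁` -/

section Branching

lemma pow_apply_mem_eigenspace {n : ℕ} {T P : Op n} (hP : P ∈ adEigen T (-1)) {c : ℂ} {v : Poly n}
    (hv : v ∈ T.eigenspace c) (m : ℕ) : (P ^ m) v ∈ T.eigenspace (c - m) := by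
  induction m with
  | zero => simpa using hv
  | succ m ih =>
    rw [pow_succ', End.mul_apply]
    convert adEigen_apply_mem hP ih using 2
    push_cast
    ring

/-- An operator of negative degree in `x_i` maps the polynomials of degree at most `m` in `x_i` to
polynomials of smaller degree in `x_i`. -/
lemma pow_partialD_apply_eq_zero {n : ℕ} {i : Fin n} {S : Submodule ℂ (Op n)} {R : Op n}
    (hR : R ∈ negPart (eulerAt i) S) {m : ℕ} {w : Poly n} (hw : (partialD i ^ (m + 1)) w = 0) :
    (partialD i ^ m) (R w) = 0 := by
  have hT := isWeightOp_eulerAt i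
  have hlow : ∀ (l : ℕ) (c : ℂ) (v : Poly n), v ∈ (eulerAt i).eigenspace c →
      (partialD i ^ l) v ∈ (eulerAt i).eigenspace (c - l) := fun l c v hv =>
    pow_apply_mem_eigenspace (partialD_mem_adEigen_eulerAt i) hv l
  have hinj : ∀ (l j : ℕ) (v : Poly n), v ∈ (eulerAt i).eigenspace (j : ℂ) → l ≤ j →
      (partialD i ^ l) v = 0 → v = 0 := by
    intro l
    induction l with
    | zero => exact fun j v _ _ h => h
    | succ l ih =>
      intro j v hv hl h
      refine ih j v hv (by omega) ?_
      -- Since `x_i ∂_i` has eigenvalue `j - l ≠ 0` on `∂_i^l v`, that vector vanishes once `∂_i`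
      -- kills it.
      have h1 := mem_eigenspace_iff.mp (hlow l j v hv)
      rw [pow_succ', End.mul_apply] at h
      rw [eulerAt, End.mul_apply, h, map_zero] at h1
      refine (smul_eq_zero.mp h1.symm).resolve_left fun h2 => ?_
      have : (j : ℂ) = l := sub_eq_zero.mp h2
      have : j = l := by exact_mod_cast this
      omega
  -- This kernel is stable under `x_i ∂_i`, so `w` splits inside it into parts of `x_i`-degree `j ≤
  -- m`. After an operator of degree `k < 0` and `∂_i^m`, the degree `j + k - m` is negative.
  let S' : Submodule ℂ (Poly n) := LinearMap.ker (partialD i ^ (m + 1))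
  have hS' : ∀ v ∈ S', eulerAt i v ∈ S' := by
    have hcomm : ∀ l : ℕ, partialD i ^ l * eulerAt i =
        eulerAt i * partialD i ^ l + (l : ℂ) • partialD i ^ l := by
      have h1 : ⁅eulerAt i, partialD i⁆ = ((-1 : ℤ) : ℂ) • partialD i :=
        partialD_mem_adEigen_eulerAt i
      rw [Ring.lie_def, Int.cast_neg, Int.cast_one, neg_smul, one_smul] at h1
      have h2 : partialD i * eulerAt i = eulerAt i * partialD i + partialD i := by
        rw [← sub_eq_iff_eq_add', ← neg_sub, h1, neg_neg]
      intro l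
      induction l with
      | zero => simp
      | succ l ih =>
        rw [pow_succ', mul_assoc, ih, mul_add, ← mul_assoc, h2, add_mul, mul_assoc, mul_smul_comm,
          Nat.cast_add, Nat.cast_one, add_smul, one_smul, add_assoc, add_comm (partialD i * _)]
    intro v hv
    have hv' : (partialD i ^ (m + 1)) v = 0 := hv
    have h := LinearMap.congr_fun (hcomm (m + 1)) v
    rw [LinearMap.add_apply, LinearMap.smul_apply, End.mul_apply, End.mul_apply, hv', map_zero,
      smul_zero, add_zero] at h
    exact h
  have hle := le_iSup_inf_eigenspace hS' hT.iSup_eigenspace_eq_top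
  have hker : ⨆ μ, S' ⊓ (eulerAt i).eigenspace μ ≤ LinearMap.ker (partialD i ^ m * R) := by
    refine iSup_le fun μ v hv => ?_
    by_cases hv0 : v = 0
    · rw [hv0]; exact zero_mem _
    obtain ⟨j, rfl⟩ := hT.exists_nat hv.2 hv0
    have hjm : j ≤ m := by
      by_contra! hlt
      exact hv0 (hinj (m + 1) j v hv.2 hlt hv.1)
    have hRle : negPart (eulerAt i) S ≤
        LinearMap.ker ((partialD i ^ m) ∘ₗ (LinearMap.applyₗ v : Op n →ₗ[ℂ] Poly n)) := by
      refine iSup₂_le fun k hk Q hQ => ?_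
      by_contra hne
      obtain ⟨l, hl⟩ := hT.exists_nat (hlow m _ _ (adEigen_apply_mem hQ.2 hv.2)) hne
      have : (l : ℤ) = j + k - m := by exact_mod_cast hl
      omega
    exact hRle hR
  exact hker (hle hw)

variable {n : ℕ} {i : Fin n} {D₁ D₂ : Subalgebra ℂ (Op n)} {a : Submodule ℂ (Op n)}

/-- By `h1` it suffices that `∂_i` and `a⁻` kill the vector. Elements of `a⁻` commute past `∂_i^m`,
and `h2` splits them into a part killing `w` and a part lowering the `x_i`-degree. -/
lemma pow_partialD_mem_lowestWeight (hpartial : partialD i ∈ D₁)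
    (ha : a ≤ Subalgebra.toSubmodule (partialConst i D₁))
    (h1 : neg D₁ ≤ Subalgebra.toSubmodule D₁ * negPart (euler n) a ⊔
      Subalgebra.toSubmodule (weyl n) * Submodule.span ℂ {partialD i})
    (h2 : negPart (euler n) a ≤
      neg D₂ ⊔ negPart (eulerAt i) (Subalgebra.toSubmodule (weyl n)))
    {N : Submodule D₁ (Poly n)} {w : Poly n} (hwN : w ∈ N) (hw : ∀ P ∈ neg D₂, P w = 0) {m : ℕ}
    (hm : (partialD i ^ (m + 1)) w = 0) : (partialD i ^ m) w ∈ lowestWeight N := by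
  have hd : partialD i ((partialD i ^ m) w) = 0 := by
    rw [← End.mul_apply, ← pow_succ', hm]
  have ha0 : ∀ P ∈ negPart (euler n) a, P ((partialD i ^ m) w) = 0 := by
    intro P hP
    have hPD : P ∈ partialConst i D₁ :=
      (iSup₂_le fun k _ => inf_le_left.trans ha :
        negPart (euler n) a ≤ Subalgebra.toSubmodule (partialConst i D₁)) hP
    have hcomm : Commute P (partialD i ^ m) :=
      Commute.pow_right (Subalgebra.mem_centralizer_iff ℂ |>.mp hPD.2 _ rfl).symm m
    obtain ⟨Q, hQ, R, hR, rfl⟩ := Submodule.mem_sup.mp (h2 hP)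
    rw [← End.mul_apply, hcomm.eq, End.mul_apply, LinearMap.add_apply, hw Q hQ, zero_add]
    exact pow_partialD_apply_eq_zero hR hm
  refine ⟨N.smul_mem (⟨partialD i ^ m, D₁.pow_mem hpartial m⟩ : D₁) hwN, fun P hP => ?_⟩
  obtain ⟨Q, hQ, R, hR, rfl⟩ := Submodule.mem_sup.mp (h1 hP)
  have hQ0 : Q ((partialD i ^ m) w) = 0 := by
    refine Submodule.mul_induction_on hQ (fun b _ c hc => ?_) (fun b c hb hc => ?_)
    · rw [End.mul_apply, ha0 c hc, map_zero]
    · rw [LinearMap.add_apply, hb, hc, add_zero]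
  have hR0 : R ((partialD i ^ m) w) = 0 := by
    refine Submodule.mul_induction_on hR (fun b _ c hc => ?_) (fun b c hb hc => ?_)
    · obtain ⟨z, rfl⟩ := Submodule.mem_span_singleton.mp hc
      rw [End.mul_apply, LinearMap.smul_apply, hd, smul_zero, map_zero]
    · rw [LinearMap.add_apply, hb, hc, add_zero]
  rw [LinearMap.add_apply, hQ0, hR0, add_zero]

/-- In a given degree, `N` has at most one vector killed by `D₂⁻`, up to scalars. -/
lemma exists_smul_eq_of_neg_apply_eq_zero (hpartial : partialD i ∈ D₁)
    (ha : a ≤ Subalgebra.toSubmodule (partialConst i D₁))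
    (h1 : neg D₁ ≤ Subalgebra.toSubmodule D₁ * negPart (euler n) a ⊔
      Subalgebra.toSubmodule (weyl n) * Submodule.span ℂ {partialD i})
    (h2 : negPart (euler n) a ≤
      neg D₂ ⊔ negPart (eulerAt i) (Subalgebra.toSubmodule (weyl n)))
    {N : Submodule D₁ (Poly n)} (hN : finrank ℂ (lowestWeight N) = 1) {d : ℂ} {v w : Poly n}
    (hvN : v ∈ N) (hv : ∀ P ∈ neg D₂, P v = 0) (hvd : v ∈ (euler n).eigenspace d) (hv0 : v ≠ 0)
    (hwN : w ∈ N) (hw : ∀ P ∈ neg D₂, P w = 0) (hwd : w ∈ (euler n).eigenspace d) :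
    ∃ c : ℂ, c • v = w := by
  classical
  have hpow : ∀ (l : ℕ) (u : Poly n), u ∈ (euler n).eigenspace d →
      (partialD i ^ l) u ∈ (euler n).eigenspace (d - l) := fun l u hu =>
    pow_apply_mem_eigenspace (partialD_mem_adEigen_euler i) hu l
  have hex : ∀ u ∈ N, (∀ P ∈ neg D₂, P u = 0) → u ∈ (euler n).eigenspace d → u ≠ 0 →
      ∃ m : ℕ, (partialD i ^ m) u ≠ 0 ∧ (partialD i ^ m) u ∈ lowestWeight N := by
    intro u huN hu hud hu0
    obtain ⟨j, rfl⟩ := (isWeightOp_euler n).exists_nat hud hu0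
    have hnil : ∃ l : ℕ, (partialD i ^ l) u = 0 := by
      refine ⟨j + 1, ?_⟩
      by_contra hne
      obtain ⟨l, hl⟩ := (isWeightOp_euler n).exists_nat (hpow (j + 1) u hud) hne
      have : (l : ℤ) = j - (j + 1 : ℕ) := by exact_mod_cast hl
      omega
    -- The exponent `m` is one less than the first power of `∂_i` that kills `u`.
    have hpos : Nat.find hnil ≠ 0 := fun h => hu0 (by simpa [h] using Nat.find_spec hnil)
    obtain ⟨m, hm⟩ := Nat.exists_eq_succ_of_ne_zero hpos
    exact ⟨m, Nat.find_min hnil (by omega), pow_partialD_mem_lowestWeight hpartial ha h1 h2 huN hu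
      (by rw [← Nat.succ_eq_add_one, ← hm]; exact Nat.find_spec hnil)⟩
  obtain ⟨m, hm0, hm⟩ := hex v hvN hv hvd hv0
  have hline : ∀ y ∈ lowestWeight N, ∃ c : ℂ, c • (partialD i ^ m) v = y := fun y hy => by
    obtain ⟨c, hc⟩ := (finrank_eq_one_iff_of_nonzero' (⟨_, hm⟩ : lowestWeight N)
      fun h => hm0 (congrArg Subtype.val h)).mp hN ⟨y, hy⟩
    exact ⟨c, congrArg Subtype.val hc⟩
  have hsame : ∀ u ∈ N, (∀ P ∈ neg D₂, P u = 0) → u ∈ (euler n).eigenspace d → u ≠ 0 →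
      (partialD i ^ m) u ≠ 0 ∧ (partialD i ^ m) u ∈ lowestWeight N := by
    intro u huN hu hud hu0
    obtain ⟨l, hl0, hl⟩ := hex u huN hu hud hu0
    obtain ⟨c, hc⟩ := hline _ hl
    have hml : (partialD i ^ l) u ∈ (euler n).eigenspace (d - m) :=
      hc ▸ Submodule.smul_mem _ c (hpow m v hvd)
    -- Vectors on the same line have the same degree, so `d - m = d - l`: the exponent does not
    -- depend on `u`.
    have heq : d - (m : ℂ) ∈ ({d - (l : ℂ)} : Set ℂ) :=
      mem_of_mem_iSup_eigenspace hl0 hml (Submodule.mem_iSup_of_mem _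
        (Submodule.mem_iSup_of_mem rfl (hpow l u hud)))
    have : m = l := by exact_mod_cast sub_right_injective (Set.mem_singleton_iff.mp heq)
    exact this ▸ ⟨hl0, hl⟩
  by_cases hw0 : w = 0
  · exact ⟨0, by rw [hw0, zero_smul]⟩
  obtain ⟨c, hc⟩ := hline _ (hsame w hwN hw hwd hw0).2
  refine ⟨c, ?_⟩
  by_contra hne
  have hcv : c • v ∈ N := N.smul_mem (algebraMap ℂ D₁ c) hvN
  -- The difference is again killed by `D₂⁻`; were it nonzero, `∂_i^m` could not kill it, yet `c`
  -- was chosen so that it does.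
  refine (hsame (c • v - w) (N.sub_mem hcv hwN) (fun P hP => ?_)
    (sub_mem (Submodule.smul_mem _ c hvd) hwd) (sub_ne_zero.mpr hne)).1 ?_
  · rw [map_sub, map_smul, hv P hP, hw P hP, smul_zero, sub_zero]
  · rw [map_sub, map_smul, hc, sub_self]

end Branching

/-! ### Multiplicity-free decomposition -/

section Decomposition

/-- A submodule of a semisimple module is the internal direct sum of simple submodules. -/
lemma exists_sSupIndep_simple_sSup_eq {R V : Type*} [Ring R] [AddCommGroup V] [Module R V]
    [IsSemisimpleModule R V] (W : Submodule R V) :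
    ∃ s : Set (Submodule R V), sSupIndep s ∧ sSup s = W ∧ ∀ m ∈ s, IsSimpleModule R m := by
  obtain ⟨s, hs, hW, hat⟩ := exists_sSupIndep_of_sSup_atoms W
    ((congrArg sSup (Set.ext fun _ => and_comm)).trans (sSup_atoms_le_eq W))
  exact ⟨s, hs, hW, fun m hm => isSimpleModule_iff_isAtom.mpr (hat hm)⟩

/-- If, in each degree, the vectors of `W` killed by `D⁻` form at most a line, then two isomorphic
simple submodules of `W` are not disjoint. -/
lemma not_disjoint_of_linearEquiv {n : ℕ} {D : Subalgebra ℂ (Op n)} (hD : IsGradedSubring D)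
    {W M M' : Submodule D (Poly n)}
    (hW : ∀ (d : ℂ) (v w : Poly n), v ∈ lowestWeight W → v ∈ (euler n).eigenspace d → v ≠ 0 →
      w ∈ lowestWeight W → w ∈ (euler n).eigenspace d → ∃ c : ℂ, c • v = w)
    (hM : M ≤ W) (hM' : M' ≤ W) (hM0 : M ≠ ⊥) (φ : M ≃ₗ[D] M') : ¬ Disjoint M M' := by
  obtain ⟨d, v, hv0, hv, hvd⟩ := exists_lowestWeight hD hM0
  let x : M := ⟨v, hv.1⟩
  -- Used with `c = 0` on `D⁻` and with `P = ∇`, `c = d`: the image of `v` is a lowest weight vector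
  -- of the same degree.
  have hφ : ∀ (P : Op n) (hP : P ∈ D) (c : ℂ), P v = c • v → P (φ x) = c • (φ x : Poly n) := by
    intro P hP c h
    have h1 := φ.map_smul (⟨P, hP⟩ : D) x
    have h2 := φ.map_smul (algebraMap ℂ D c) x
    exact congrArg Subtype.val (h1.symm.trans ((congrArg φ (Subtype.ext h)).trans h2))
  have hw : (φ x : Poly n) ∈ lowestWeight W := by
    refine ⟨hM' (φ x).2, fun P hP => ?_⟩
    have hPD : P ∈ D := (iSup₂_le fun _ _ => inf_le_left : neg D ≤ Subalgebra.toSubmodule D) hP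
    have := hφ P hPD 0 (by rw [hv.2 P hP, zero_smul])
    rwa [zero_smul] at this
  have hwd : (φ x : Poly n) ∈ (euler n).eigenspace d :=
    mem_eigenspace_iff.mpr (hφ _ hD.euler_mem d (mem_eigenspace_iff.mp hvd))
  obtain ⟨c, hc⟩ := hW d v _ ⟨hM hv.1, hv.2⟩ hvd hv0 hw hwd
  intro hdis
  have hmem : (φ x : Poly n) ∈ M := hc ▸ M.smul_mem (algebraMap ℂ D c) hv.1
  have h0 := Submodule.disjoint_def.mp hdis _ hmem (φ x).2
  have hx0 : x = 0 := φ.map_eq_zero_iff.mp (Subtype.ext h0)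
  exact hv0 (congrArg Subtype.val hx0)

end Decomposition

end BranchRule

end

theorem theorem5p2 (n : ℕ) (D₁ D₂ : Subalgebra ℂ (BranchRule.Op (n + 1)))
    (hD₁ : BranchRule.IsGradedSubring D₁) (hD₂ : BranchRule.IsGradedSubring D₂)
    (hD : D₂ ≤ D₁)
    (hx : BranchRule.mulX (Fin.last n) ∈ D₁) (hpartial : BranchRule.partialD (Fin.last n) ∈ D₁)
    (a₁ : LieSubalgebra ℂ (BranchRule.Op (n + 1)))
    (ha_le : a₁.toSubmodule ≤
      Subalgebra.toSubmodule (BranchRule.partialConst (Fin.last n) D₁))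
    (ha_graded : BranchRule.IsGraded a₁.toSubmodule)
    (h1a : BranchRule.negPart (BranchRule.euler (n + 1)) a₁.toSubmodule ≤
      BranchRule.neg (BranchRule.partialConst (Fin.last n) D₁))
    (h1b : BranchRule.neg (BranchRule.partialConst (Fin.last n) D₁) ≤ BranchRule.neg D₁)
    (h1c : BranchRule.neg D₁ ≤
      Subalgebra.toSubmodule D₁ *
          BranchRule.negPart (BranchRule.euler (n + 1)) a₁.toSubmodule ⊔
        Subalgebra.toSubmodule (BranchRule.weyl (n + 1)) *
          Submodule.span ℂ {BranchRule.partialD (Fin.last n)})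
    (h2 : BranchRule.negPart (BranchRule.euler (n + 1)) a₁.toSubmodule ≤
      BranchRule.neg D₂ ⊔
        BranchRule.negPart (BranchRule.eulerAt (Fin.last n))
          (Subalgebra.toSubmodule (BranchRule.weyl (n + 1))))
    (N : Submodule D₁ (BranchRule.Poly (n + 1))) (hN : IsSimpleModule D₁ N) :
    ((∀ a b : BranchRule.weightRing D₁, a * b = b * a) →
      (∀ a b : BranchRule.weightRing D₂, a * b = b * a) →
      Module.finrank ℂ (BranchRule.lowestWeight N) = 1 ∧
      ∀ M : Submodule D₂ (BranchRule.Poly (n + 1)), M ≤ BranchRule.res hD N →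
        IsSimpleModule D₂ M → Module.finrank ℂ (BranchRule.lowestWeight M) = 1) ∧
    (IsSemisimpleModule D₂ (BranchRule.Poly (n + 1)) →
      Module.finrank ℂ (BranchRule.lowestWeight N) = 1 →
      (∀ M : Submodule D₂ (BranchRule.Poly (n + 1)), M ≤ BranchRule.res hD N →
        IsSimpleModule D₂ M → Module.finrank ℂ (BranchRule.lowestWeight M) = 1) →
      ∃ (ι : Type) (M : ι → Submodule D₂ (BranchRule.Poly (n + 1))),
        (∀ i, IsSimpleModule D₂ (M i)) ∧
        (∀ i j, i ≠ j → IsEmpty (M i ≃ₗ[D₂] M j)) ∧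
        iSupIndep M ∧ (⨆ i, M i) = BranchRule.res hD N) := by
  refine ⟨fun hc₁ hc₂ => ⟨BranchRule.finrank_lowestWeight_eq_one hD₁ hc₁ hN, fun M _ hM =>
    BranchRule.finrank_lowestWeight_eq_one hD₂ hc₂ hM⟩, fun hss hN1 _ => ?_⟩
  obtain ⟨s, hs, hsup, hsimple⟩ := BranchRule.exists_sSupIndep_simple_sSup_eq
    (BranchRule.res hD N)
  refine ⟨s, Subtype.val, fun M => hsimple M M.2, fun M M' hne => ⟨fun φ => ?_⟩,
    sSupIndep_iff s |>.mp hs, by rw [← sSup_eq_iSup', hsup]⟩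
  have hM0 : (M : Submodule D₂ (BranchRule.Poly (n + 1))) ≠ ⊥ :=
    (isSimpleModule_iff_isAtom.mp (hsimple M M.2)).1
  -- Distinct members of the independent family are disjoint, which an isomorphism between them
  -- would contradict.
  refine BranchRule.not_disjoint_of_linearEquiv hD₂ (W := BranchRule.res hD N) ?_
    (hsup ▸ le_sSup M.2) (hsup ▸ le_sSup M'.2) hM0 φ
    (hs.pairwiseDisjoint M.2 M'.2 fun h => hne (Subtype.ext h))
  intro d v w hv hvd hv0 hw hwd
  exact BranchRule.exists_smul_eq_of_neg_apply_eq_zero hpartial ha_le h1c h2 hN1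
    hv.1 hv.2 hvd hv0 hw.1 hw.2 hwd
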